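/- For an integer $n\ge 1$ and $s\in\mathbb{C}$ let $$S_n(s)=\sum_{k=0}^{n-1}(-1)^k\binom{n-1}{k}(k+1)^{-s}.$$ Write $a_n\sim b_n$ if $a_n-b_n=o(b_n)$ as $n\to\infty$ (so $a_n/b_n\to 1$ when $b_n\neq 0$ for all large $n$). Then: 1. For every $s\in\mathbb{C}$ that is not an integer, $\displaystyle S_n(s)\sim\frac{1}{n(\log n)^{1-s}\,\Gamma(s)}$ as $n\to\infty$. 2. For every integer $k\ge 1$, $\displaystyle S_n(k)\sim\frac{(\log n)^{k-1}}{n\,(k-1)!}$ as $n\to\infty$. 3. For every integer $k\ge 0$ there is $N=N(k)$ such that $S_n(-k)=0$ for all $n\ge N$. -/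

import Mathlib

/-- The alternating binomial sum `S_n(s) = ∑_{k=0}^{n-1} (-1)^k * binom(n-1, k) * (k+1)^(-s)`,
for `n ≥ 1` and complex `s` (for `n = 0` the sum is empty). The base `k + 1` is a positive
real number, so the complex power is `exp (-s * log (k + 1))` with the real logarithm. -/
noncomputable def serSum (n : ℕ) (s : ℂ) : ℂ :=
  ∑ k ∈ Finset.range n, (-1 : ℂ) ^ k * ((n - 1).choose k : ℂ) * ((k : ℂ) + 1) ^ (-s)

open Filter Topology MeasureTheory Set Asymptotics

/-! Expanding `(1 - e^{-t})^m` gives `Γ(s) S_{m+1}(s) = ∫₀^∞ t^(s-1) e^{-t} (1 - e^{-t})^m dt` for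
`Re s > 0`. The kernel is `O(t^m)` at `0`, so `integral_expKernel` extends this to `Re s > -m` off
the poles of `Γ`. With `n = m + 1`, the mass sits near `t = L = log n`: after `t = x + L`, `n` times
the kernel tends to the Gumbel density `e^{-x} e^{-e^{-x}}`, of mass 1, while `t^(s-1)` behaves like
`L^(s-1)`. Dominated convergence yields `n Γ(s) S_n(s) ~ L^(s-1)`, which covers both asymptotic
claims. At the poles `s = -k`, the sum is a finite difference of order `n - 1` of a polynomial of
degree `k`, hence zero for `n ≥ k + 2`. -/

/-! ### Recursion in `s` and vanishing at nonpositive integers -/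

theorem serSum_succ (m : ℕ) (s : ℂ) :
    serSum (m + 1) s =
      ∑ k ∈ Finset.range (m + 1), (-1 : ℂ) ^ k * (m.choose k : ℂ) * ((k : ℂ) + 1) ^ (-s) := rfl

/-- Comes from `(k+1) C(m+1,k) = (m+2) C(m+1,k) - (m+1) C(m,k)`. It drives both the vanishing at
`-k` and the continuation of the Mellin formula. -/
theorem serSum_recursion (m : ℕ) (s : ℂ) :
    serSum (m + 2) s =
      (m + 2) * serSum (m + 2) (s + 1) - (m + 1) * serSum (m + 1) (s + 1) := by
  have h : serSum (m + 1) (s + 1) = ∑ k ∈ Finset.range (m + 2),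
      (-1 : ℂ) ^ k * (m.choose k : ℂ) * ((k : ℂ) + 1) ^ (-(s + 1)) := by
    rw [Finset.sum_range_succ, serSum_succ]
    simp
  rw [h, serSum_succ, serSum_succ, Finset.mul_sum, Finset.mul_sum, ← Finset.sum_sub_distrib]
  refine Finset.sum_congr rfl fun k hk => ?_
  have hk1 : (k : ℂ) + 1 ≠ 0 := Nat.cast_add_one_ne_zero k
  have hpow : ((k : ℂ) + 1) ^ (-s) = (k + 1) * ((k : ℂ) + 1) ^ (-(s + 1)) := by
    rw [show -s = 1 + -(s + 1) by ring, Complex.cpow_add _ _ hk1, Complex.cpow_one]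
  have hc : (m.choose k : ℂ) * (m + 1) = ((m + 1).choose k : ℂ) * (m + 1 - k) := by
    have h1 := Nat.choose_mul_succ_eq m k
    have hk2 : k ≤ m + 1 := by simpa [Nat.lt_succ_iff] using hk
    have h2 := congrArg (Nat.cast : ℕ → ℂ) h1
    push_cast [Nat.cast_sub hk2] at h2
    exact h2
  rw [hpow]
  linear_combination (-1 : ℂ) ^ k * ((k : ℂ) + 1) ^ (-(s + 1)) * hc

theorem serSum_zero_right (m : ℕ) : serSum (m + 2) 0 = 0 := by
  have h := add_pow (-1 : ℂ) 1 (m + 1)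
  rw [serSum_succ]
  simp only [neg_add_cancel, one_pow, mul_one, ne_eq, Nat.add_eq_zero_iff, one_ne_zero, and_false,
    not_false_eq_true, zero_pow] at h
  simpa using h.symm

theorem serSum_neg_natCast_eq_zero (k m : ℕ) : serSum (k + m + 2) (-(k : ℂ)) = 0 := by
  induction k generalizing m with
  | zero => simpa using serSum_zero_right m
  | succ k ih =>
    rw [serSum_recursion, show -((k + 1 : ℕ) : ℂ) + 1 = -(k : ℂ) by push_cast; ring,
      show k + 1 + m + 2 = k + (m + 1) + 2 by ring, ih,
      show k + 1 + m + 1 = k + m + 2 by ring, ih]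
    simp

/-! ### Mellin transform and its continuation -/

/-- The function `e^{-t} (1 - e^{-t})^m`, whose Mellin transform is `Γ(s) S_{m+1}(s)`. -/
noncomputable def expKernel (m : ℕ) (t : ℝ) : ℝ := Real.exp (-t) * (1 - Real.exp (-t)) ^ m

theorem continuous_expKernel (m : ℕ) : Continuous (expKernel m) := by
  unfold expKernel; fun_prop

theorem expKernel_nonneg (m : ℕ) {t : ℝ} (ht : 0 ≤ t) : 0 ≤ expKernel m t := by
  have : Real.exp (-t) ≤ 1 := Real.exp_le_one_iff.2 (by linarith)
  exact mul_nonneg (Real.exp_nonneg _) (pow_nonneg (by linarith) _)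

theorem expKernel_le (m : ℕ) {t : ℝ} (ht : 0 ≤ t) : expKernel m t ≤ Real.exp (-t) * t ^ m := by
  have h1 : Real.exp (-t) ≤ 1 := Real.exp_le_one_iff.2 (by linarith)
  have h2 := Real.add_one_le_exp (-t)
  unfold expKernel
  gcongr
  linarith

theorem hasDerivAt_expKernel_succ (m : ℕ) (t : ℝ) :
    HasDerivAt (expKernel (m + 1)) ((m + 1) * expKernel m t - (m + 2) * expKernel (m + 1) t) t := by
  have h : HasDerivAt (fun t => Real.exp (-t)) (-Real.exp (-t)) t := by
    simpa using (hasDerivAt_neg t).exp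
  convert! h.mul ((h.const_sub 1).fun_pow (m + 1)) using 1
  simp only [expKernel]
  push_cast
  ring

theorem norm_cpow_mul_expKernel_le (m : ℕ) (s : ℂ) {t : ℝ} (ht : 0 < t) :
    ‖(t : ℂ) ^ s * (expKernel m t : ℂ)‖ ≤ Real.exp (-t) * t ^ (s.re + m) := by
  rw [norm_mul, Complex.norm_cpow_eq_rpow_re_of_pos ht, Complex.norm_real,
    Real.norm_of_nonneg (expKernel_nonneg m ht.le), Real.rpow_add ht, Real.rpow_natCast]
  calc _ ≤ t ^ s.re * (Real.exp (-t) * t ^ m) := by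
        gcongr
        exact expKernel_le m ht.le
    _ = _ := by ring

theorem continuousOn_cpow_mul_expKernel (m : ℕ) (s : ℂ) :
    ContinuousOn (fun t : ℝ => (t : ℂ) ^ s * (expKernel m t : ℂ)) (Ioi 0) := by
  refine ContinuousOn.mul (fun t ht => ?_)
    (Complex.continuous_ofReal.comp (continuous_expKernel m)).continuousOn
  exact (Complex.continuousAt_ofReal_cpow_const t s (Or.inr (ne_of_gt ht))).continuousWithinAt

theorem integrableOn_cpow_mul_expKernel (m : ℕ) (s : ℂ) (hs : -(m : ℝ) < s.re) :
    IntegrableOn (fun t : ℝ => (t : ℂ) ^ (s - 1) * (expKernel m t : ℂ)) (Ioi 0) := by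
  refine (Real.GammaIntegral_convergent (s := s.re + m) (by linarith)).mono'
    ((continuousOn_cpow_mul_expKernel m _).aestronglyMeasurable measurableSet_Ioi) ?_
  filter_upwards [ae_restrict_mem measurableSet_Ioi] with t ht
  convert norm_cpow_mul_expKernel_le m (s - 1) ht using 3
  simp; ring

theorem tendsto_exp_neg_mul_rpow_nhdsGT {a : ℝ} (ha : 0 < a) :
    Tendsto (fun t : ℝ => Real.exp (-t) * t ^ a) (𝓝[>] 0) (𝓝 0) := by
  have : ContinuousAt (fun t : ℝ => Real.exp (-t) * t ^ a) 0 :=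
    (by fun_prop : ContinuousAt (fun t : ℝ => Real.exp (-t)) 0).mul
      (Real.continuousAt_rpow_const _ _ (Or.inr ha.le))
  simpa [Real.zero_rpow ha.ne'] using this.tendsto.mono_left nhdsWithin_le_nhds

theorem tendsto_exp_neg_mul_rpow_atTop (a : ℝ) :
    Tendsto (fun t : ℝ => Real.exp (-t) * t ^ a) atTop (𝓝 0) := by
  simpa [mul_comm] using tendsto_rpow_mul_exp_neg_mul_atTop_nhds_zero a 1 one_pos

theorem integral_expKernel_of_re_pos (m : ℕ) {s : ℂ} (hs : 0 < s.re) :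
    ∫ t : ℝ in Ioi 0, (t : ℂ) ^ (s - 1) * (expKernel m t : ℂ) =
      Complex.Gamma s * serSum (m + 1) s := by
  have hmellin (k : ℕ) : ∫ t : ℝ in Ioi 0,
      (t : ℂ) ^ (s - 1) * Complex.exp (-(((k : ℂ) + 1) * t)) =
      (1 / ((k : ℂ) + 1)) ^ s * Complex.Gamma s := by
    simpa using Complex.integral_cpow_mul_exp_neg_mul_Ioi hs (r := (k : ℝ) + 1) (by positivity)
  have hint (k : ℕ) : IntegrableOn
      (fun t : ℝ => (t : ℂ) ^ (s - 1) * Complex.exp (-(((k : ℂ) + 1) * t))) (Ioi 0) := by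
    -- A non-integrable function has integral `0` by convention, but the value in `hmellin` is
    -- nonzero.
    by_contra hcon
    have h0 := integral_undef hcon
    rw [hmellin] at h0
    have hk : 1 / ((k : ℂ) + 1) ≠ 0 := one_div_ne_zero (Nat.cast_add_one_ne_zero k)
    exact mul_ne_zero (fun h => hk ((Complex.cpow_eq_zero_iff _ _).1 h).1)
      (Complex.Gamma_ne_zero_of_re_pos hs) h0
  have hexp (t : ℝ) : (t : ℂ) ^ (s - 1) * (expKernel m t : ℂ) =
      ∑ k ∈ Finset.range (m + 1), (-1 : ℂ) ^ k * (m.choose k : ℂ) *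
        ((t : ℂ) ^ (s - 1) * Complex.exp (-(((k : ℂ) + 1) * t))) := by
    have : (expKernel m t : ℂ) = Complex.exp (-t) * (-Complex.exp (-t) + 1) ^ m := by
      simp only [expKernel]; push_cast; ring
    rw [this, add_pow, Finset.mul_sum, Finset.mul_sum]
    refine Finset.sum_congr rfl fun k _ => ?_
    rw [neg_pow, ← Complex.exp_nat_mul,
      show -(((k : ℂ) + 1) * t) = -t + k * -t by ring, Complex.exp_add]
    ring
  simp_rw [hexp]
  rw [integral_finsetSum _ fun k _ => (hint k).const_mul _, serSum_succ, Finset.mul_sum]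
  refine Finset.sum_congr rfl fun k _ => ?_
  rw [integral_const_mul, hmellin, one_div,
    Complex.cpow_neg, Complex.inv_cpow]
  · ring
  · rw [← Nat.cast_add_one, Complex.natCast_arg]
    exact Real.pi_pos.ne

/-- Integration by parts; the boundary terms vanish because `Re s + m + 1 > 0`. This mirrors
`serSum_recursion`, so the Mellin formula passes from `s + 1` to `s`. -/
theorem integral_expKernel_recursion (m : ℕ) {s : ℂ} (hs : -((m : ℝ) + 1) < s.re) :
    s * ∫ t : ℝ in Ioi 0, (t : ℂ) ^ (s - 1) * (expKernel (m + 1) t : ℂ) =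
      (m + 2) * (∫ t : ℝ in Ioi 0, (t : ℂ) ^ s * (expKernel (m + 1) t : ℂ)) -
        (m + 1) * ∫ t : ℝ in Ioi 0, (t : ℂ) ^ s * (expKernel m t : ℂ) := by
  have hi0 : IntegrableOn (fun t : ℝ => (t : ℂ) ^ s * (expKernel m t : ℂ)) (Ioi 0) := by
    simpa using integrableOn_cpow_mul_expKernel m (s + 1) (by simp; linarith)
  have hi1 : IntegrableOn (fun t : ℝ => (t : ℂ) ^ s * (expKernel (m + 1) t : ℂ)) (Ioi 0) := by
    simpa using integrableOn_cpow_mul_expKernel (m + 1) (s + 1) (by simp; linarith)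
  have hi2 : IntegrableOn
      (fun t : ℝ => (t : ℂ) ^ (s - 1) * (expKernel (m + 1) t : ℂ)) (Ioi 0) :=
    integrableOn_cpow_mul_expKernel (m + 1) s (by push_cast; linarith)
  have hu (t : ℝ) (ht : t ∈ Ioi (0 : ℝ)) :
      HasDerivAt (fun t : ℝ => (t : ℂ) ^ s) (s * (t : ℂ) ^ (s - 1)) t := by
    have := (hasDerivAt_id (t : ℂ)).cpow_const (c := s) (Or.inl ht)
    simpa using this.comp_ofReal
  have hv (t : ℝ) (_ : t ∈ Ioi (0 : ℝ)) : HasDerivAt (fun t : ℝ => (expKernel (m + 1) t : ℂ))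
      ((m + 1) * (expKernel m t : ℂ) - (m + 2) * (expKernel (m + 1) t : ℂ)) t := by
    simpa using (hasDerivAt_expKernel_succ m t).ofReal_comp
  have hbound : ∀ t ∈ Ioi (0 : ℝ), ‖(t : ℂ) ^ s * (expKernel (m + 1) t : ℂ)‖ ≤
      Real.exp (-t) * t ^ (s.re + (m + 1 : ℕ)) := fun t ht => norm_cpow_mul_expKernel_le (m + 1) s ht
  have hz : Tendsto (fun t : ℝ => (t : ℂ) ^ s * (expKernel (m + 1) t : ℂ)) (𝓝[>] 0) (𝓝 0) :=
    squeeze_zero_norm' (eventually_mem_nhdsWithin.mono hbound)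
      (tendsto_exp_neg_mul_rpow_nhdsGT (by push_cast; linarith))
  have ht : Tendsto (fun t : ℝ => (t : ℂ) ^ s * (expKernel (m + 1) t : ℂ)) atTop (𝓝 0) :=
    squeeze_zero_norm' ((eventually_gt_atTop 0).mono hbound) (tendsto_exp_neg_mul_rpow_atTop _)
  have huv (t : ℝ) : (t : ℂ) ^ s * ((m + 1) * (expKernel m t : ℂ) -
      (m + 2) * (expKernel (m + 1) t : ℂ)) = (m + 1) * ((t : ℂ) ^ s * (expKernel m t : ℂ)) -
      (m + 2) * ((t : ℂ) ^ s * (expKernel (m + 1) t : ℂ)) := by ring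
  have hi3 := (hi0.const_mul ((m : ℂ) + 1)).sub (hi1.const_mul ((m : ℂ) + 2))
  have key := integral_Ioi_mul_deriv_eq_deriv_mul hu hv
    (hi3.congr (Eventually.of_forall fun t => (huv t).symm))
    ((hi2.const_mul s).congr (Eventually.of_forall fun t => (mul_assoc _ _ _).symm)) hz ht
  simp_rw [huv, mul_assoc s] at key
  rw [integral_sub (hi0.const_mul _) (hi1.const_mul _),
    integral_const_mul, integral_const_mul, integral_const_mul] at key
  linear_combination key

/-- The Mellin transform representation of `serSum`, beyond the half-plane where the individual
terms are integrable. -/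
theorem integral_expKernel (j : ℕ) : ∀ (m : ℕ) (s : ℂ), j ≤ m → -(j : ℝ) < s.re →
    (∀ i : ℕ, s ≠ -(i : ℂ)) →
    ∫ t : ℝ in Ioi 0, (t : ℂ) ^ (s - 1) * (expKernel m t : ℂ) =
      Complex.Gamma s * serSum (m + 1) s := by
  induction j with
  | zero => exact fun m s _ hs _ => integral_expKernel_of_re_pos m (by simpa using hs)
  | succ j ih =>
    intro m s hjm hs hne
    obtain ⟨m, rfl⟩ : ∃ n, m = n + 1 := ⟨m - 1, by omega⟩
    have hs0 : s ≠ 0 := by simpa using hne 0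
    have hne' (i : ℕ) : s + 1 ≠ -(i : ℂ) := fun h => hne (i + 1) (by
      push_cast; linear_combination h)
    push_cast at hs
    have hjm' : (j : ℝ) ≤ m := by exact_mod_cast Nat.le_of_succ_le_succ hjm
    have h1 := ih (m + 1) (s + 1) (by omega) (by simp; linarith) hne'
    have h2 := ih m (s + 1) (by omega) (by simp; linarith) hne'
    have h3 := integral_expKernel_recursion m (s := s) (by linarith)
    simp only [add_sub_cancel_right] at h1 h2
    rw [h1, h2, Complex.Gamma_add_one s hs0] at h3
    rw [serSum_recursion m s]
    refine mul_left_cancel₀ hs0 ?_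
    linear_combination h3

/-! ### Integrable majorant for the recentred kernel -/

theorem integrable_comp_abs_of_integrableOn_Ioi {f : ℝ → ℝ} (hf : IntegrableOn f (Ioi 0)) :
    Integrable fun x : ℝ => f |x| := by
  have h1 : IntegrableOn (fun x : ℝ => f |x|) (Ioi 0) :=
    hf.congr_fun (fun x hx => by simp [abs_of_pos (mem_Ioi.1 hx)]) measurableSet_Ioi
  have h2 : IntegrableOn (fun x : ℝ => f |x|) (Iio 0) := by
    have := h1.comp_neg
    simpa using this
  have h3 := ((integrableOn_Iic_iff_integrableOn_Iio (by simp)).2 h2).union h1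
  rwa [Iic_union_Ioi, integrableOn_univ] at h3

theorem integrable_pow_mul_exp_neg_abs (p : ℕ) :
    Integrable fun x : ℝ => 8 * ((2 + 2 * |x|) ^ p * Real.exp (-|x|)) := by
  refine (integrable_comp_abs_of_integrableOn_Ioi
    (f := fun x => (2 + 2 * x) ^ p * Real.exp (-x)) ?_).const_mul 8
  have h : (fun x : ℝ => (2 + 2 * x) ^ p * Real.exp (-x)) =
      fun x => ∑ k ∈ Finset.range (p + 1),
        (2 ^ k * 2 ^ (p - k) * (p.choose k : ℝ)) * (Real.exp (-x) * x ^ (p - k)) := by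
    ext x
    rw [add_pow, Finset.sum_mul]
    exact Finset.sum_congr rfl fun k _ => by rw [mul_pow]; ring
  rw [h]
  refine integrable_finsetSum _ fun k _ => Integrable.const_mul ?_ _
  have := Real.GammaIntegral_convergent (s := (p - k : ℕ) + 1) (by positivity)
  simpa [IntegrableOn] using this

/-- For `x ≤ 0`, put `v = e^{-x}` and use `e^{v/2} ≥ v²/8`; this is the source of the 8. -/
theorem exp_mul_exp_neg_exp_le (x : ℝ) :
    Real.exp (-x) * Real.exp (-(Real.exp (-x) / 2)) ≤ 8 * Real.exp (-|x|) := by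
  have hv : 0 < Real.exp (-x) := Real.exp_pos _
  rcases le_total 0 x with hx | hx
  · rw [abs_of_nonneg hx]
    have : Real.exp (-(Real.exp (-x) / 2)) ≤ 1 := Real.exp_le_one_iff.2 (by linarith)
    nlinarith
  · rw [abs_of_nonpos hx, neg_neg, ← neg_neg x, Real.exp_neg (-x), neg_neg]
    set v := Real.exp (-x)
    have h := Real.quadratic_le_exp_of_nonneg (x := v / 2) (by positivity)
    rw [Real.exp_neg, ← div_eq_mul_inv, ← div_eq_mul_inv, div_le_div_iff₀ (Real.exp_pos _) hv]
    nlinarith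

/-- The integrand of the Mellin transform of `expKernel m`, recentred at `L` and normalised. -/
noncomputable def scaledKernel (s : ℂ) (m : ℕ) (L x : ℝ) : ℂ :=
  (Ioi (-L)).indicator (fun x : ℝ => ((1 + x / L : ℝ) : ℂ) ^ (s - 1) *
    ((Real.exp L * expKernel m (x + L) : ℝ) : ℂ)) x

theorem integral_expKernel_eq_scaledKernel (s : ℂ) (m : ℕ) {L : ℝ} (hL : 0 < L) :
    Real.exp L * ∫ t : ℝ in Ioi 0, (t : ℂ) ^ (s - 1) * (expKernel m t : ℂ) =
      (L : ℂ) ^ (s - 1) * ∫ x, scaledKernel s m L x := by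
  rw [← integral_indicator measurableSet_Ioi,
    ← integral_add_right_eq_self (μ := volume) _ L, ← integral_const_mul, ← integral_const_mul]
  congr 1 with x
  by_cases hx : -L < x
  · have hx' : 0 < x + L := by linarith
    have h1 : 0 ≤ 1 + x / L := by
      rw [show 1 + x / L = (x + L) / L by field_simp; ring]; positivity
    rw [scaledKernel, indicator_of_mem (mem_Ioi.2 hx), indicator_of_mem (mem_Ioi.2 hx'),
      show x + L = L * (1 + x / L) by field_simp; ring, Complex.ofReal_mul L (1 + x / L),
      Complex.mul_cpow_ofReal_nonneg hL.le h1]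
    push_cast
    ring
  · have hx' : ¬ 0 < x + L := by linarith
    simp [scaledKernel, hx, hx']

theorem measurable_scaledKernel (s : ℂ) (m : ℕ) (L : ℝ) : Measurable (scaledKernel s m L) := by
  refine Measurable.indicator ?_ measurableSet_Ioi
  have := (continuous_expKernel m).measurable
  fun_prop

/-- For negative `a`, `p` factors `1 - e^{-t} ≤ t` absorb the singularity of `(t/L)^a` at `0`,
uniformly in `L`. -/
theorem rpow_mul_pow_le {a L t : ℝ} {p : ℕ} (hap : |a| ≤ p) (hL : 1 ≤ L) (ht : 0 < t) :
    (t / L) ^ a * (1 - Real.exp (-t)) ^ p ≤ (2 + 2 * |t - L|) ^ p := by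
  have hL0 : 0 < L := by linarith
  have he1 : 0 ≤ 1 - Real.exp (-t) := by
    have := Real.exp_le_one_iff.2 (neg_nonpos.2 ht.le); linarith
  have he2 : 1 - Real.exp (-t) ≤ 1 := by linarith [Real.exp_pos (-t)]
  have he3 : 1 - Real.exp (-t) ≤ t := by linarith [Real.add_one_le_exp (-t)]
  obtain ⟨ha1, ha2⟩ := abs_le.1 hap
  have hw : 0 < t / L := by positivity
  rcases le_total L t with h | h
  · have h1 : 1 ≤ t / L := by rwa [le_div_iff₀ hL0, one_mul]
    have h2 : t / L ≤ 2 + 2 * |t - L| := by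
      rw [abs_of_nonneg (by linarith), div_le_iff₀ hL0]
      nlinarith
    calc _ ≤ (t / L) ^ (p : ℝ) * 1 ^ p := by gcongr
      _ ≤ _ := by rw [one_pow, mul_one, Real.rpow_natCast]; gcongr
  · have h1 : t / L ≤ 1 := by rwa [div_le_iff₀ hL0, one_mul]
    have h2 : (t / L)⁻¹ * (1 - Real.exp (-t)) ≤ 2 + 2 * |t - L| := by
      rw [abs_of_nonpos (by linarith), inv_div, div_mul_eq_mul_div, div_le_iff₀ ht]
      rcases le_total L (2 * t) with h3 | h3
      · nlinarith
      · nlinarith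
    calc _ ≤ (t / L) ^ (-p : ℝ) * (1 - Real.exp (-t)) ^ p := by
          gcongr ?_ * _
          exact Real.rpow_le_rpow_of_exponent_ge hw h1 ha1
      _ = ((t / L)⁻¹ * (1 - Real.exp (-t))) ^ p := by
          rw [Real.rpow_neg hw.le, Real.rpow_natCast, mul_pow, inv_pow]
      _ ≤ _ := by gcongr

theorem norm_scaledKernel_le {s : ℂ} {m p : ℕ} (hp : |s.re - 1| ≤ p) (hm : 2 * p + 1 ≤ m)
    {L : ℝ} (hL : Real.exp L = m + 1) (hL1 : 1 ≤ L) (x : ℝ) :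
    ‖scaledKernel s m L x‖ ≤ 8 * ((2 + 2 * |x|) ^ p * Real.exp (-|x|)) := by
  by_cases hx : x ∈ Ioi (-L)
  swap
  · rw [scaledKernel, indicator_of_notMem hx, norm_zero]
    positivity
  have ht : 0 < x + L := by have := mem_Ioi.1 hx; linarith
  have hL0 : 0 < L := by linarith
  have hw : 1 + x / L = (x + L) / L := by field_simp; ring
  have hwpos : 0 < (x + L) / L := by positivity
  have he1 : 0 ≤ 1 - Real.exp (-(x + L)) := by
    have := Real.exp_le_one_iff.2 (neg_nonpos.2 ht.le); linarith
  have hexp : Real.exp L * Real.exp (-(x + L)) = Real.exp (-x) := by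
    rw [← Real.exp_add]; congr 1; ring
  -- After `p` factors are spent on the power of `t`, `m - p ≥ (m + 1)/2` remain, whence the `1/2`
  -- in the exponent.
  have hpow : (1 - Real.exp (-(x + L))) ^ (m - p) ≤ Real.exp (-(Real.exp (-x) / 2)) := by
    calc _ ≤ Real.exp (-Real.exp (-(x + L))) ^ (m - p) := by
          gcongr
          exact Real.one_sub_le_exp_neg _
      _ = Real.exp (-(Real.exp (-(x + L)) * (m - p))) := by
          rw [← Real.exp_nat_mul, Nat.cast_sub (by omega)]; congr 1; ring
      _ ≤ _ := by
          have hm' : (2 * p + 1 : ℝ) ≤ m := by exact_mod_cast hm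
          rw [Real.exp_le_exp, neg_le_neg_iff, ← hexp, hL]
          nlinarith [Real.exp_pos (-(x + L))]
  rw [scaledKernel, indicator_of_mem hx, norm_mul, hw,
    Complex.norm_cpow_eq_rpow_re_of_pos hwpos, Complex.norm_real,
    Real.norm_of_nonneg (mul_nonneg (Real.exp_nonneg _) (expKernel_nonneg m ht.le))]
  have hA := rpow_mul_pow_le hp hL1 ht
  rw [add_sub_cancel_right] at hA
  calc _ = (((x + L) / L) ^ (s.re - 1) * (1 - Real.exp (-(x + L))) ^ p) *
        (Real.exp (-x) * (1 - Real.exp (-(x + L))) ^ (m - p)) := by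
        rw [expKernel, ← hexp, ← Nat.add_sub_cancel' (show p ≤ m by omega), pow_add]
        simp
        ring
    _ ≤ (2 + 2 * |x|) ^ p * (Real.exp (-x) * Real.exp (-(Real.exp (-x) / 2))) := by gcongr
    _ ≤ (2 + 2 * |x|) ^ p * (8 * Real.exp (-|x|)) := by
        exact mul_le_mul_of_nonneg_left (exp_mul_exp_neg_exp_le x) (by positivity)
    _ = _ := by ring

/-! ### Gumbel limit and asymptotics -/

theorem tendsto_log_natCast_add_one : Tendsto (fun m : ℕ => Real.log (m + 1)) atTop atTop :=
  Real.tendsto_log_atTop.comp (tendsto_atTop_add_const_right _ _ tendsto_natCast_atTop_atTop)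

theorem tendsto_scaledKernel (s : ℂ) (x : ℝ) :
    Tendsto (fun m : ℕ => scaledKernel s m (Real.log (m + 1)) x) atTop
      (𝓝 ((Real.exp (-x) * Real.exp (-Real.exp (-x)) : ℝ) : ℂ)) := by
  have hL := tendsto_log_natCast_add_one
  have h1 : Tendsto (fun m : ℕ => ((1 + x / Real.log (m + 1) : ℝ) : ℂ) ^ (s - 1)) atTop (𝓝 1) := by
    have ha : Tendsto (fun m : ℕ => 1 + x / Real.log (m + 1)) atTop (𝓝 1) := by
      simpa using (hL.const_div_atTop x).const_add 1
    have hb : ContinuousAt (fun t : ℝ => (t : ℂ) ^ (s - 1)) 1 :=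
      Complex.continuousAt_ofReal_cpow_const 1 _ (Or.inr one_ne_zero)
    simpa [Function.comp_def] using hb.tendsto.comp ha
  have h2 : Tendsto (fun m : ℕ => (1 + -(Real.exp (-x) / (m + 1))) ^ m) atTop
      (𝓝 (Real.exp (-Real.exp (-x)))) := by
    apply Real.tendsto_one_add_pow_exp_of_tendsto
    have := (tendsto_natCast_div_add_atTop (1 : ℝ)).const_mul (-Real.exp (-x))
    rw [mul_one] at this
    exact this.congr fun m => by ring
  have h3 := h1.mul ((Complex.continuous_ofReal.tendsto _).comp (h2.const_mul (Real.exp (-x))))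
  rw [one_mul] at h3
  refine h3.congr' ?_
  filter_upwards [hL.eventually_gt_atTop (-x)] with m hm
  have hpos : (0 : ℝ) < m + 1 := by positivity
  have hexp : Real.exp (-(x + Real.log (m + 1))) = Real.exp (-x) / (m + 1) := by
    rw [neg_add, Real.exp_add, Real.exp_neg (Real.log _), Real.exp_log hpos, div_eq_mul_inv]
  rw [scaledKernel, indicator_of_mem (mem_Ioi.2 (by linarith)), expKernel, hexp,
    Real.exp_log hpos, ← mul_assoc, mul_div_cancel₀ _ hpos.ne']
  simp [sub_eq_add_neg]

theorem integral_exp_neg_mul_exp_neg_exp :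
    ∫ x : ℝ, Real.exp (-x) * Real.exp (-Real.exp (-x)) = 1 := by
  have hd (x : ℝ) : HasDerivAt (fun x => Real.exp (-Real.exp (-x)))
      (Real.exp (-x) * Real.exp (-Real.exp (-x))) x := by
    have h : HasDerivAt (fun t => Real.exp (-t)) (-Real.exp (-x)) x := by
      simpa using (hasDerivAt_neg x).exp
    refine h.fun_neg.exp.congr_deriv ?_
    rw [neg_neg, mul_comm]
  have hi : Integrable fun x : ℝ => Real.exp (-x) * Real.exp (-Real.exp (-x)) := by
    refine (integrable_pow_mul_exp_neg_abs 0).mono' (by fun_prop)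
      (Eventually.of_forall fun x => ?_)
    rw [Real.norm_of_nonneg (by positivity), pow_zero, one_mul]
    refine le_trans ?_ (exp_mul_exp_neg_exp_le x)
    gcongr
    linarith [Real.exp_pos (-x)]
  have hbot : Tendsto (fun x : ℝ => Real.exp (-Real.exp (-x))) atBot (𝓝 0) :=
    Real.tendsto_exp_neg_atTop_nhds_zero.comp (Real.tendsto_exp_atTop.comp tendsto_neg_atBot_atTop)
  have htop : Tendsto (fun x : ℝ => Real.exp (-Real.exp (-x))) atTop (𝓝 1) := by
    simpa [Function.comp_def] using (Real.continuous_exp.tendsto _).comp Real.tendsto_exp_neg_atTop_nhds_zero.neg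
  rw [integral_of_hasDerivAt_of_tendsto hd hi hbot htop, sub_zero]

theorem tendsto_integral_scaledKernel (s : ℂ) :
    Tendsto (fun m : ℕ => ∫ x, scaledKernel s m (Real.log (m + 1)) x) atTop (𝓝 1) := by
  obtain ⟨p, hp⟩ := exists_nat_ge |s.re - 1|
  have h := tendsto_integral_filter_of_dominated_convergence _
    (Eventually.of_forall fun m : ℕ =>
      (measurable_scaledKernel s m (Real.log (m + 1))).aestronglyMeasurable)
    (by
      filter_upwards [eventually_ge_atTop (2 * p + 1),
        tendsto_log_natCast_add_one.eventually_ge_atTop 1] with m hm hL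
      exact Eventually.of_forall
        (norm_scaledKernel_le hp hm (Real.exp_log (by positivity)) hL))
    (integrable_pow_mul_exp_neg_abs p)
    (Eventually.of_forall (tendsto_scaledKernel s))
  rwa [integral_complex_ofReal, integral_exp_neg_mul_exp_neg_exp, Complex.ofReal_one] at h

theorem serSum_isEquivalent {s : ℂ} (hs : ∀ i : ℕ, s ≠ -(i : ℂ)) :
    (fun n : ℕ => serSum n s) ~[atTop]
      fun n : ℕ => ((Real.log n : ℝ) : ℂ) ^ (s - 1) / (n * Complex.Gamma s) := by
  have hG : Complex.Gamma s ≠ 0 := Complex.Gamma_ne_zero hs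
  obtain ⟨j, hj⟩ := exists_nat_gt (-s.re)
  -- The ratio of the two sides is exactly this integral once `n ≥ j + 2`: then the Mellin formula
  -- applies and `log n > 0`.
  refine isEquivalent_iff_exists_eq_mul.2 ⟨fun n : ℕ =>
    ∫ x, scaledKernel s (n - 1) (Real.log ((n - 1 : ℕ) + 1)) x,
    (tendsto_integral_scaledKernel s).comp (tendsto_sub_atTop_nat 1), ?_⟩
  filter_upwards [eventually_ge_atTop (j + 2)] with n hn
  obtain ⟨m, rfl⟩ : ∃ m, n = m + 1 := ⟨n - 1, by omega⟩
  have hm1 : (1 : ℝ) < m + 1 := by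
    have : (1 : ℝ) ≤ m := by exact_mod_cast (by omega : 1 ≤ m)
    linarith
  have h1 := integral_expKernel_eq_scaledKernel s m (Real.log_pos hm1)
  rw [integral_expKernel j m s (by omega) (by linarith) hs, Real.exp_log (by positivity)] at h1
  have hm : (m : ℂ) + 1 ≠ 0 := Nat.cast_add_one_ne_zero m
  simp only [Pi.mul_apply, Nat.add_sub_cancel]
  push_cast at h1 ⊢
  field_simp
  linear_combination h1

theorem lemma2p2 :
    (∀ s : ℂ, (∀ m : ℤ, s ≠ (m : ℂ)) →
      Asymptotics.IsEquivalent Filter.atTop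
        (fun n : ℕ => serSum n s)
        (fun n : ℕ => 1 / ((n : ℂ) * ((Real.log (n : ℝ) : ℝ) : ℂ) ^ (1 - s) * Complex.Gamma s))) ∧
    (∀ k : ℕ, 1 ≤ k →
      Asymptotics.IsEquivalent Filter.atTop
        (fun n : ℕ => serSum n (k : ℂ))
        (fun n : ℕ => ((Real.log (n : ℝ) : ℝ) : ℂ) ^ (k - 1) /
          ((n : ℂ) * ((k - 1).factorial : ℂ)))) ∧
    (∀ k : ℕ, ∀ᶠ n : ℕ in Filter.atTop, serSum n (-(k : ℂ)) = 0) := by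
  refine ⟨fun s hs => ?_, fun k hk => ?_, fun k => ?_⟩
  · have h := serSum_isEquivalent (s := s) fun i => by simpa using hs (-i)
    refine h.congr_right (Eventually.of_forall fun n => ?_)
    dsimp only
    rw [← neg_sub 1 s, Complex.cpow_neg, div_eq_mul_inv, one_div]
    simp only [mul_inv]
    ring
  · obtain ⟨k, rfl⟩ : ∃ j, k = j + 1 := ⟨k - 1, by omega⟩
    have h := serSum_isEquivalent (s := ((k + 1 : ℕ) : ℂ)) fun i hi => by
      have : ((k + 1 + i : ℕ) : ℂ) = 0 := by push_cast at hi ⊢; linear_combination hi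
      exact absurd (Nat.cast_eq_zero.1 this) (by omega)
    refine h.congr_right (Eventually.of_forall fun n => ?_)
    dsimp only
    push_cast
    rw [Complex.Gamma_nat_eq_factorial, add_sub_cancel_right, Complex.cpow_natCast]
  · filter_upwards [eventually_ge_atTop (k + 2)] with n hn
    obtain ⟨m, rfl⟩ := Nat.exists_eq_add_of_le hn
    rw [show k + 2 + m = k + m + 2 by ring]
    exact serSum_neg_natCast_eq_zero k m
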